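/- Let $k,n\ge 0$ be integers. To a $k$-tuple $\pi=(\pi_1,\dots,\pi_k)$ of permutations of $\{1,\dots,n\}$ associate the $k$-regular bipartite multigraph $X_\pi$ with $n$ inputs $1,\dots,n$ and $n$ outputs $1,\dots,n$, having one edge between the input $i$ and the output $\pi_a(i)$ for every $a\in\{1,\dots,k\}$ and every $i\in\{1,\dots,n\}$. For a real number $c$, a $k$-regular bipartite multigraph with $n$ inputs and $n$ outputs is an $(n,k,c)$-bi-expander if every set $A$ of inputs with $|A|\le n/2$ satisfies $|\partial A|\ge(1+c)|A|$, where $\partial A$ is the set of outputs adjacent to some element of $A$. A $k\times n$ Latin rectangle is a $k\times n$ matrix with entries in $\{1,\dots,n\}$ in which no entry is repeated within a row or within a column. Let $\beta_n(k,c)$ be the number of $k$-tuples $\pi$ for which $X_\pi$ is not an $(n,k,c)$-bi-expander, let $N_n(k)$ be the number of $k$-tuples $\pi$ for which $X_\pi$ has no multiple edges, and let $\beta'_n(k,c)$ be the number of $k$-tuples $\pi$ for which $X_\pi$ has no multiple edges and is not an $(n,k,c)$-bi-expander. Then: 1. $X_\pi$ has no multiple edges if and only if the matrix $(\pi_a(i))_{a,i}$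 is a $k\times n$ Latin rectangle; the number $N_n(k)$ is equal to the number of $k\times n$ Latin rectangles; and $N_n(k)>0$ whenever $k\le n$. 2. For every fixed $k$ and every real $c$: if the proportion of bad $k$-tuples among all $k$-tuples of permutations, $\beta_n(k,c)/(n!)^k$, tends to $0$ as $n\to\infty$, then so does the proportion $\beta'_n(k,c)/N_n(k)$ of bad $k$-tuples among those whose multigraph has no multiple edges. 3. There is a constant $c>0$ such that for every fixed $k\ge 3$ $$\lim_{n\to\infty}\frac{\beta'_n(k,c)}{N_n(k)}=0,$$ that is, the proportion of $k\times n$ Latin rectangles that fail to give $(n,k,c)$-bi-expanders tends to $0$. -/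

import Mathlib

open Filter Topology

/-- The neighbours of the set of vertices `A` in the multigraph `G`: the vertices joined by an
edge to a vertex of `A`. If `A` lies in one part of a bipartite multigraph, all of them are
outside of `A`. -/
def nbhd {α β : Type*} (G : Graph α β) (A : Set α) : Set α :=
  {y | ∃ x ∈ A, G.Adj x y}

/-- `G` is an `(n, k, c)`-bi-expander with inputs `I` and outputs `O`: a `k`-regular bipartite
multigraph with parts `I` and `O`, both of size `n`, such that every set `A` of at most `n / 2`
inputs has at least `(1 + c) |A|` neighbours. Degrees count edges with multiplicity. -/
structure IsBiExpander {α β : Type*} (G : Graph α β) (I O : Set α) (n k : ℕ) (c : ℝ) : Prop where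
  disjoint : Disjoint I O
  union_eq : I ∪ O = G.vertexSet
  encard_inputs : I.encard = n
  encard_outputs : O.encard = n
  bipartite : ∀ e ∈ G.edgeSet, ∃ x ∈ I, ∃ y ∈ O, G.IsLink e x y
  regular : ∀ v ∈ G.vertexSet, (G.incidenceSet v).encard = k
  expands : ∀ A ⊆ I, (A.ncard : ℝ) ≤ (n : ℝ) / 2 →
    (1 + c) * (A.ncard : ℝ) ≤ ((nbhd G A).ncard : ℝ)

/-- The bipartite multigraph of a `k`-tuple `π` of permutations of an `n`-element set: inputs
`Sum.inl i`, outputs `Sum.inr j`, and one edge, labelled `(a, i)`, between the input `i` and the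
output `π a i`, for all `a` and `i`. -/
def permGraph {n k : ℕ} (π : Fin k → Equiv.Perm (Fin n)) :
    Graph (Fin n ⊕ Fin n) (Fin k × Fin n) where
  vertexSet := Set.univ
  IsLink e x y :=
    (x = Sum.inl e.2 ∧ y = Sum.inr (π e.1 e.2)) ∨ (x = Sum.inr (π e.1 e.2) ∧ y = Sum.inl e.2)
  isLink_symm := fun _ _ => ⟨fun _ _ h => h.symm.imp And.symm And.symm⟩
  eq_or_eq_of_isLink_of_isLink := by
    rintro e x y v w (⟨rfl, rfl⟩ | ⟨rfl, rfl⟩) (⟨rfl, rfl⟩ | ⟨rfl, rfl⟩) <;> simp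
  left_mem_of_isLink := fun _ _ _ _ => Set.mem_univ _

/-- The bad `k`-tuples of permutations: those whose multigraph is not an
`(n, k, c)`-bi-expander. -/
def badTuples (n k : ℕ) (c : ℝ) : Set (Fin k → Equiv.Perm (Fin n)) :=
  {π | ¬ IsBiExpander (permGraph π) (Set.range Sum.inl) (Set.range Sum.inr) n k c}

/-- The `k`-tuples of permutations whose multigraph has no multiple edges. (There are never
loops, so this is simplicity of the multigraph.) -/
def simpleTuples (n k : ℕ) : Set (Fin k → Equiv.Perm (Fin n)) :=
  {π | (permGraph π).Simple}

/-- A `k × n` Latin rectangle: entries in an `n`-element set of symbols, no symbol repeated in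
a row or in a column. -/
def IsLatinRectangle {n k : ℕ} (A : Matrix (Fin k) (Fin n) (Fin n)) : Prop :=
  (∀ a, Function.Injective (fun i => A a i)) ∧ (∀ i, Function.Injective (fun a => A a i))

/-- The `k × n` matrix `(π_a(i))` of a `k`-tuple of permutations. -/
def permMatrix {n k : ℕ} (π : Fin k → Equiv.Perm (Fin n)) : Matrix (Fin k) (Fin n) (Fin n) :=
  Matrix.of fun a i => π a i

/-! Tuples without multiple edges have density at least some `1 / C`, with `C` depending only on
`k`, among all `k`-tuples once `n` is large, so a family of density zero keeps density zero inside
them. The density bound goes by induction on `k`: given `k` permutations, a random `σ` agrees with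
them at no more than `k` places on average, so at least half of all `σ` have at most `2 * k`
agreements. Switching by transpositions then removes agreements one at a time, each costing a factor
`1 + 2 * k` (`factorial_le_mul_card_agreeSet_eq_empty`).

Expansion with `c = 1 / 128` is a union bound over pairs of sets `A`, `B` of sizes `a` and `a + a /
128` with every `π a` mapping `A` into `B` (`ncard_badTuples_div_le`). For `k ≥ 3` the term at `a`
is bounded by a geometric sequence independent of `n` and tends to `0` for fixed `a`, so dominated
convergence finishes. -/

/-! ### Permutations mapping one set into another. -/

open Finset in
lemma exists_perm_mem_iff {α : Type*} [Fintype α] [DecidableEq α] {A B : Finset α}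
    (h : #A = #B) : ∃ τ : Equiv.Perm α, ∀ i, i ∈ A ↔ τ i ∈ B :=
  ⟨(Finset.equivOfCardEq h).extendSubtype, fun i =>
    ⟨(Finset.equivOfCardEq h).extendSubtype_mem i, fun hi => by
      by_contra hA
      exact (Finset.equivOfCardEq h).extendSubtype_not_mem i hA hi⟩⟩

open Finset in
/-- The number of permutations mapping a set of size `a` into a set of size `b` is
`n! * b.choose a / n.choose a`. -/
lemma choose_mul_card_perm_mapsTo {n : ℕ} (A B : Finset (Fin n)) :
    n.choose #A * #{σ : Equiv.Perm (Fin n) | ∀ i ∈ A, σ i ∈ B} = n.factorial * (#B).choose #A := by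
  have key : ∀ A' ∈ powersetCard #A (univ : Finset (Fin n)),
      #{σ : Equiv.Perm (Fin n) | ∀ i ∈ A', σ i ∈ B} =
        #{σ : Equiv.Perm (Fin n) | ∀ i ∈ A, σ i ∈ B} := by
    intro A' hA'
    have hc : #A = #A' := (mem_powersetCard.1 hA').2.symm
    obtain ⟨τ, hτ⟩ := exists_perm_mem_iff hc
    refine card_equiv (Equiv.mulRight τ) fun σ => ?_
    simp only [mem_filter, mem_univ, true_and, Equiv.coe_mulRight, Equiv.Perm.mul_apply]
    refine ⟨fun h i hi => h _ ((hτ i).1 hi), fun h i hi => ?_⟩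
    have := h (τ.symm i) ((hτ _).2 (by simpa using hi))
    rwa [Equiv.apply_symm_apply] at this
  have h1 : ∀ σ : Equiv.Perm (Fin n),
      #{A' ∈ powersetCard #A (univ : Finset (Fin n)) | ∀ i ∈ A', σ i ∈ B} = (#B).choose #A := by
    intro σ
    rw [← card_map σ.symm.toEmbedding (s := B), ← card_powersetCard]
    congr 1
    ext A'
    simp only [mem_filter, mem_powersetCard, subset_univ, true_and]
    rw [and_comm]
    refine and_congr_left fun _ => ?_
    simp [subset_iff]
  -- Double count the pairs `(A', σ)` with `σ` mapping `A'` into `B`: the count for `A'` depends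
  -- only on its size, and for fixed `σ` the sets `A'` are the subsets of the preimage of `B` of
  -- that size.
  have h2 := sum_card_bipartiteAbove_eq_sum_card_bipartiteBelow
    (s := powersetCard #A (univ : Finset (Fin n))) (t := (univ : Finset (Equiv.Perm (Fin n))))
    (fun A' σ => ∀ i ∈ A', σ i ∈ B)
  simp only [bipartiteAbove, bipartiteBelow] at h2
  rw [sum_congr rfl key, sum_congr rfl fun σ _ => h1 σ] at h2
  simpa [-mul_eq_mul_left_iff, -mul_eq_mul_right_iff, Fintype.card_perm] using h2

/-! ### Permutations avoiding a given tuple, by switching. -/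

/-- The inputs at which `σ` agrees with a member of the tuple `π`. -/
def agreeSet {n k : ℕ} (π : Fin k → Equiv.Perm (Fin n)) (σ : Equiv.Perm (Fin n)) :
    Finset (Fin n) :=
  {i | ∃ a, π a i = σ i}

lemma mem_agreeSet {n k : ℕ} {π : Fin k → Equiv.Perm (Fin n)} {σ : Equiv.Perm (Fin n)}
    {i : Fin n} : i ∈ agreeSet π σ ↔ ∃ a, π a i = σ i := by
  simp [agreeSet]

-- Composing with a transposition at an agreement `i` destroys it. At least `n - 2 * k` choices of
-- the other point create no new agreement, and each result arises from at most `n * k`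
-- permutations; since `4 * k ≤ n`, the ratio is at most `2 * k`.
open Finset in
lemma card_agreeSet_succ_mul_le {n k : ℕ} (π : Fin k → Equiv.Perm (Fin n)) (hn : 4 * k ≤ n)
    (hn0 : 0 < n) (t : ℕ) :
    #{σ | #(agreeSet π σ) ≤ t + 1} ≤ (1 + 2 * k) * #{σ | #(agreeSet π σ) ≤ t} := by
  have hswitch : #{σ | #(agreeSet π σ) = t + 1} * (n - 2 * k) ≤
      #{σ | #(agreeSet π σ) ≤ t} * (n * k) := by
    refine card_mul_le_card_mul
      (fun σ τ => ∃ i i' a, τ = σ * Equiv.swap i i' ∧ π a i = σ i) ?_ ?_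
    · intro σ hσ
      simp only [mem_filter, mem_univ, true_and] at hσ
      obtain ⟨i, hi⟩ : (agreeSet π σ).Nonempty := by
        rw [← card_pos]; omega
      obtain ⟨a, ha⟩ : ∃ a, π a i = σ i := mem_agreeSet.1 hi
      let good : Finset (Fin n) := {i' | (∀ b, π b i ≠ σ i') ∧ ∀ b, π b i' ≠ σ i}
      have hgood : n - 2 * k ≤ #good := by
        have hc : goodᶜ ⊆ (univ.image fun b => σ.symm (π b i)) ∪
            (univ.image fun b => (π b).symm (σ i)) := by
          intro x hx
          simp only [good, mem_compl, mem_filter, mem_univ, true_and, not_and_or, not_forall,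
            not_not] at hx
          simp only [mem_union, mem_image, mem_univ, true_and, Equiv.symm_apply_eq]
          rcases hx with ⟨b, hb⟩ | ⟨b, hb⟩
          · exact Or.inl ⟨b, hb⟩
          · exact Or.inr ⟨b, hb.symm⟩
        have h1 := card_le_card hc
        have h2 := card_union_le (univ.image fun b => σ.symm (π b i))
          (univ.image fun b => (π b).symm (σ i))
        have h3 : #(univ.image fun b => σ.symm (π b i)) ≤ k := card_image_le.trans (by simp)
        have h4 : #(univ.image fun b => (π b).symm (σ i)) ≤ k := card_image_le.trans (by simp)
        have h5 := card_compl good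
        rw [Fintype.card_fin] at h5
        omega
      refine hgood.trans (card_le_card_of_injOn (fun i' => σ * Equiv.swap i i') ?_ ?_)
      · intro i' hi'
        simp only [good, coe_filter, mem_univ, true_and, Set.mem_ofPred_eq] at hi'
        simp only [bipartiteAbove, coe_filter, mem_filter, mem_univ, true_and, Set.mem_ofPred_eq]
        refine ⟨?_, i, i', a, rfl, ha⟩
        have hsub : agreeSet π (σ * Equiv.swap i i') ⊆ (agreeSet π σ).erase i := by
          intro x hx
          rw [mem_agreeSet] at hx
          rw [mem_erase, mem_agreeSet]
          obtain ⟨b, hb⟩ := hx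
          rw [Equiv.Perm.mul_apply] at hb
          rcases eq_or_ne x i with rfl | hxi
          · rw [Equiv.swap_apply_left] at hb
            exact absurd hb (hi'.1 b)
          rcases eq_or_ne x i' with rfl | hxi'
          · rw [Equiv.swap_apply_right] at hb
            exact absurd hb (hi'.2 b)
          rw [Equiv.swap_apply_of_ne_of_ne hxi hxi'] at hb
          exact ⟨hxi, b, hb⟩
        have := card_le_card hsub
        rw [card_erase_of_mem hi] at this
        omega
      · intro x _ y _ hxy
        have := congrArg (fun s : Equiv.Perm (Fin n) => s i) (mul_left_cancel hxy)
        simpa using this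
    · intro τ _
      have hsub : bipartiteBelow (fun σ τ => ∃ i i' a, τ = σ * Equiv.swap i i' ∧ π a i = σ i)
          ({σ | #(agreeSet π σ) = t + 1} : Finset (Equiv.Perm (Fin n))) τ ⊆
          -- The pair `(i, a)` determines the switch: `τ i' = σ i = π a i` recovers `i'`, hence `σ`.
          univ.image fun p : Fin n × Fin k =>
            τ * Equiv.swap p.1 (τ.symm (π p.2 p.1)) := by
        intro σ hσ
        simp only [bipartiteBelow, mem_filter] at hσ
        obtain ⟨-, i, i', a, rfl, ha⟩ := hσ
        simp only [mem_image, mem_univ, true_and]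
        refine ⟨(i, a), ?_⟩
        have : (σ * Equiv.swap i i').symm (π a i) = i' := by
          rw [Equiv.symm_apply_eq, ha]; simp
        simp [this, mul_assoc]
      exact (card_le_card hsub).trans (card_image_le.trans (by simp))
  have hsplit : #{σ | #(agreeSet π σ) ≤ t + 1} ≤
      #{σ | #(agreeSet π σ) ≤ t} + #{σ | #(agreeSet π σ) = t + 1} := by
    rw [← card_union_of_disjoint]
    · refine card_le_card fun σ => ?_
      simp only [mem_filter, mem_univ, true_and, mem_union]
      omega
    · rw [disjoint_filter]; intros; omega
  have hle : #{σ | #(agreeSet π σ) = t + 1} ≤ 2 * k * #{σ | #(agreeSet π σ) ≤ t} := by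
    have h : n ≤ 2 * (n - 2 * k) := by omega
    refine Nat.le_of_mul_le_mul_left ?_ hn0
    calc n * #{σ | #(agreeSet π σ) = t + 1}
        ≤ 2 * (n - 2 * k) * #{σ | #(agreeSet π σ) = t + 1} := Nat.mul_le_mul_right _ h
      _ = 2 * (#{σ | #(agreeSet π σ) = t + 1} * (n - 2 * k)) := by ring
      _ ≤ 2 * (#{σ | #(agreeSet π σ) ≤ t} * (n * k)) := Nat.mul_le_mul_left _ hswitch
      _ = _ := by ring
  linarith [hsplit, hle]

-- Markov's inequality: the mean number of agreements is at most `k`, each of the `n * k` possible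
-- ones having probability `1 / n`.
open Finset in
lemma factorial_le_two_mul_card_agreeSet_le {n k : ℕ} (π : Fin k → Equiv.Perm (Fin n)) :
    n.factorial ≤ 2 * #{σ | #(agreeSet π σ) ≤ 2 * k} := by
  have hsum : ∑ σ, #(agreeSet π σ) ≤ k * n.factorial := by
    have h1 : ∑ σ, #(agreeSet π σ) = ∑ i, #{σ : Equiv.Perm (Fin n) | ∃ a, π a i = σ i} :=
      sum_card_bipartiteAbove_eq_sum_card_bipartiteBelow
        (fun (σ : Equiv.Perm (Fin n)) i => ∃ a, π a i = σ i)
    have h2 : ∀ i, n * #{σ : Equiv.Perm (Fin n) | ∃ a, π a i = σ i} ≤ k * n.factorial := by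
      intro i
      have hsub : ({σ : Equiv.Perm (Fin n) | ∃ a, π a i = σ i} : Finset _) ⊆
          univ.biUnion fun a : Fin k =>
            ({σ : Equiv.Perm (Fin n) | ∀ j ∈ ({i} : Finset (Fin n)), σ j ∈ ({π a i} : Finset _)} :
              Finset _) := by
        intro σ
        simp [eq_comm]
      calc n * #{σ : Equiv.Perm (Fin n) | ∃ a, π a i = σ i}
          ≤ n * ∑ a : Fin k, #{σ : Equiv.Perm (Fin n) |
              ∀ j ∈ ({i} : Finset (Fin n)), σ j ∈ ({π a i} : Finset _)} :=
            Nat.mul_le_mul_left _ ((card_le_card hsub).trans card_biUnion_le)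
        _ = ∑ a : Fin k, n.factorial := by
            rw [mul_sum]
            refine sum_congr rfl fun a _ => ?_
            simpa using choose_mul_card_perm_mapsTo {i} {π a i}
        _ = _ := by simp
    rcases Nat.eq_zero_or_pos n with rfl | hn
    · rw [h1]; simp
    · rw [h1]
      refine Nat.le_of_mul_le_mul_left ?_ hn
      rw [mul_sum]
      exact (sum_le_sum fun i _ => h2 i).trans (by simp)
  have hmarkov : (2 * k + 1) * #{σ | ¬ #(agreeSet π σ) ≤ 2 * k} ≤ k * n.factorial := by
    refine le_trans ?_ hsum
    rw [mul_comm, ← smul_eq_mul]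
    refine (card_nsmul_le_sum _ (fun σ => #(agreeSet π σ)) _ fun σ hσ => ?_).trans
      (sum_le_sum_of_subset (filter_subset _ _))
    simp only [mem_filter, mem_univ, true_and] at hσ
    omega
  have htot : #{σ | #(agreeSet π σ) ≤ 2 * k} + #{σ | ¬ #(agreeSet π σ) ≤ 2 * k} = n.factorial := by
    rw [card_filter_add_card_filter_not]; simp [Fintype.card_perm]
  nlinarith

open Finset in
/-- A positive proportion of all permutations disagrees everywhere with `k` given ones. -/
lemma factorial_le_mul_card_agreeSet_eq_empty {n k : ℕ} (π : Fin k → Equiv.Perm (Fin n))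
    (hn : 4 * k ≤ n) (hn0 : 0 < n) :
    n.factorial ≤ 2 * (1 + 2 * k) ^ (2 * k) * #{σ | agreeSet π σ = ∅} := by
  have h : ∀ t, #{σ | #(agreeSet π σ) ≤ t} ≤ (1 + 2 * k) ^ t * #{σ | agreeSet π σ = ∅} := by
    intro t
    induction t with
    | zero => simp
    | succ t ih =>
      refine (card_agreeSet_succ_mul_le π hn hn0 t).trans ?_
      rw [pow_succ', mul_assoc]
      exact Nat.mul_le_mul_left _ ih
  rw [mul_assoc]
  exact (factorial_le_two_mul_card_agreeSet_le π).trans (Nat.mul_le_mul_left _ (h _))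

/-! ### Simple multigraphs and Latin rectangles. -/

lemma mem_simpleTuples_iff {n k : ℕ} {π : Fin k → Equiv.Perm (Fin n)} :
    π ∈ simpleTuples n k ↔ ∀ i, Function.Injective fun a => π a i := by
  change (permGraph π).Simple ↔ _
  constructor
  · intro h i a b hab
    have h1 : (permGraph π).IsLink (a, i) (Sum.inl i) (Sum.inr (π a i)) := Or.inl ⟨rfl, rfl⟩
    have h2 : (permGraph π).IsLink (b, i) (Sum.inl i) (Sum.inr (π a i)) :=
      Or.inl ⟨rfl, congrArg Sum.inr hab⟩
    exact congrArg Prod.fst (h.eq_of_isLink h1 h2)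
  · intro h
    refine { not_isLoopAt := ?_, eq_of_isLink := ?_ }
    · rintro e x (⟨h1, h2⟩ | ⟨h1, h2⟩) <;> simp [h1] at h2
    · rintro ⟨a, i⟩ ⟨b, j⟩ x y (⟨h1, h2⟩ | ⟨h1, h2⟩) (⟨h3, h4⟩ | ⟨h3, h4⟩) <;>
        subst h1 <;> subst h2 <;> simp at h3 h4
      · subst h3
        rw [h i h4]
      · subst h4
        rw [h i h3]

lemma mem_simpleTuples_iff_isLatinRectangle {n k : ℕ} (π : Fin k → Equiv.Perm (Fin n)) :
    π ∈ simpleTuples n k ↔ IsLatinRectangle (permMatrix π) := by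
  rw [mem_simpleTuples_iff]
  exact ⟨fun h => ⟨fun a => (π a).injective, h⟩, fun h => h.2⟩

lemma ncard_simpleTuples_eq_ncard_isLatinRectangle (n k : ℕ) :
    (simpleTuples n k).ncard =
      {A : Matrix (Fin k) (Fin n) (Fin n) | IsLatinRectangle A}.ncard := by
  refine Set.ncard_congr (fun π _ => permMatrix π)
    (fun π h => (mem_simpleTuples_iff_isLatinRectangle π).1 h) ?_ ?_
  · intro π ρ _ _ h
    funext a
    ext i
    exact congrArg Fin.val (congrFun (congrFun h a) i)
  · intro A hA
    refine ⟨fun a => Equiv.ofBijective (fun i => A a i) (Finite.injective_iff_bijective.1 (hA.1 a)),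
      ?_, rfl⟩
    exact mem_simpleTuples_iff.2 hA.2

lemma ncard_simpleTuples_pos {n k : ℕ} (h : k ≤ n) : 0 < (simpleTuples n k).ncard := by
  refine (Set.ncard_pos (Set.toFinite _)).2 ?_
  rcases Nat.eq_zero_or_pos n with rfl | hn
  · exact ⟨fun _ => 1, mem_simpleTuples_iff.2 fun i => i.elim0⟩
  · have : NeZero n := ⟨hn.ne'⟩
    -- The cyclic Latin rectangle, with entries `i + a` modulo `n`.
    refine ⟨fun a => Equiv.addRight (Fin.castLE h a), mem_simpleTuples_iff.2 fun i a b hab => ?_⟩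
    simpa using hab

/-! ### Positive density of simple tuples, and transfer. -/

open Finset in
lemma ncard_simpleTuples (n k : ℕ) : (simpleTuples n k).ncard =
    #{π : Fin k → Equiv.Perm (Fin n) | ∀ i, Function.Injective fun a => π a i} := by
  rw [← Set.ncard_coe_finset]
  congr 1
  ext π
  simp [mem_simpleTuples_iff]

open Finset in
/-- A positive proportion of all `k`-tuples of permutations gives Latin rectangles. -/
lemma exists_factorial_pow_le_mul_ncard_simpleTuples (k : ℕ) :
    ∃ C : ℕ, ∀ n, 4 * k ≤ n → 0 < n → n.factorial ^ k ≤ C * (simpleTuples n k).ncard := by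
  induction k with
  | zero => exact ⟨1, fun n _ _ => by
      simpa using Nat.one_le_iff_ne_zero.2 (ncard_simpleTuples_pos (Nat.zero_le n)).ne'⟩
  | succ k ih =>
    obtain ⟨C, hC⟩ := ih
    refine ⟨C * (2 * (1 + 2 * k) ^ (2 * k)), fun n hn hn0 => ?_⟩
    set D := 2 * (1 + 2 * k) ^ (2 * k)
    have hstep : (simpleTuples n k).ncard * n.factorial ≤ D * (simpleTuples n (k + 1)).ncard := by
      rw [ncard_simpleTuples, ncard_simpleTuples]
      calc _ ≤ ∑ π ∈ {π : Fin k → Equiv.Perm (Fin n) | ∀ i, Function.Injective fun a => π a i},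
            D * #{σ | agreeSet π σ = ∅} := by
            rw [← smul_eq_mul]
            exact card_nsmul_le_sum _ _ _ fun π _ =>
              factorial_le_mul_card_agreeSet_eq_empty π (by omega) hn0
        _ ≤ _ := by
            rw [← mul_sum, ← card_sigma]
            refine Nat.mul_le_mul_left _ (card_le_card_of_injOn
              (fun p => (Fin.cons p.2 p.1 : Fin (k + 1) → Equiv.Perm (Fin n))) ?_ ?_)
            · rintro ⟨π, σ⟩ h
              simp only [coe_sigma, Set.mem_sigma_iff, coe_filter, mem_univ, true_and,
                Set.mem_ofPred_eq, eq_empty_iff_forall_notMem, mem_agreeSet, not_exists] at h ⊢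
              intro i a b
              refine Fin.cases ?_ (fun a => ?_) a <;> refine Fin.cases ?_ (fun b => ?_) b
              · simp
              · intro hab
                exact absurd hab.symm (h.2 i b)
              · intro hab
                exact absurd hab (h.2 i a)
              · intro hab
                exact congrArg Fin.succ (h.1 i hab)
            · rintro ⟨π, σ⟩ _ ⟨π', σ'⟩ _ h
              obtain ⟨rfl, rfl⟩ := Fin.cons_injective2 h
              rfl
    calc n.factorial ^ (k + 1) = n.factorial ^ k * n.factorial := pow_succ _ _
      _ ≤ C * (simpleTuples n k).ncard * n.factorial :=
        Nat.mul_le_mul_right _ (hC n (by omega) hn0)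
      _ = C * ((simpleTuples n k).ncard * n.factorial) := by ring
      _ ≤ C * (D * (simpleTuples n (k + 1)).ncard) := Nat.mul_le_mul_left _ hstep
      _ = _ := by ring

/-- A family of tuples of asymptotic density `0` also has density `0` among the tuples without
multiple edges. -/
lemma tendsto_ncard_inter_simpleTuples_div {k : ℕ} (B : ∀ n, Set (Fin k → Equiv.Perm (Fin n)))
    (h : Tendsto (fun n : ℕ => ((B n).ncard : ℝ) / (n.factorial : ℝ) ^ k) atTop (𝓝 0)) :
    Tendsto (fun n : ℕ => ((B n ∩ simpleTuples n k).ncard : ℝ) / ((simpleTuples n k).ncard : ℝ))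
      atTop (𝓝 0) := by
  obtain ⟨C, hC⟩ := exists_factorial_pow_le_mul_ncard_simpleTuples k
  have h0 : Tendsto (fun n : ℕ => (C : ℝ) * (((B n).ncard : ℝ) / (n.factorial : ℝ) ^ k))
      atTop (𝓝 0) := by simpa using h.const_mul (C : ℝ)
  refine squeeze_zero' (Eventually.of_forall fun n => by positivity) ?_ h0
  filter_upwards [eventually_ge_atTop (4 * k), eventually_gt_atTop 0] with n hn hn0
  have hpos : (0 : ℝ) < (simpleTuples n k).ncard := by
    exact_mod_cast ncard_simpleTuples_pos (by omega)
  have hle : ((B n ∩ simpleTuples n k).ncard : ℝ) ≤ (B n).ncard := by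
    exact_mod_cast Set.ncard_le_ncard Set.inter_subset_left (Set.toFinite _)
  have hC' : (n.factorial : ℝ) ^ k ≤ C * (simpleTuples n k).ncard := by
    exact_mod_cast hC n hn hn0
  rw [← mul_div_assoc, div_le_div_iff₀ hpos (by positivity)]
  calc ((B n ∩ simpleTuples n k).ncard : ℝ) * (n.factorial : ℝ) ^ k
      ≤ (B n).ncard * (C * (simpleTuples n k).ncard) := by gcongr
    _ = _ := by ring

/-! ### Non-expanding tuples and the union bound. -/

lemma encard_incidenceSet_permGraph {n k : ℕ} (π : Fin k → Equiv.Perm (Fin n))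
    (v : Fin n ⊕ Fin n) : ((permGraph π).incidenceSet v).encard = k := by
  rcases v with i | j
  · have h : (permGraph π).incidenceSet (Sum.inl i) = Set.range fun a => (a, i) := by
      ext ⟨a, x⟩
      simp only [Graph.mem_incidenceSet, Graph.Inc, permGraph, Set.mem_range, Prod.mk.injEq]
      constructor
      · rintro ⟨y, ⟨h, -⟩ | ⟨h, -⟩⟩
        · exact ⟨a, rfl, Sum.inl.inj h⟩
        · simp at h
      · rintro ⟨b, rfl, rfl⟩
        exact ⟨_, Or.inl ⟨rfl, rfl⟩⟩
    rw [h, ← Set.image_univ, Function.Injective.encard_image fun a b h => congrArg Prod.fst h]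
    simp
  · have h : (permGraph π).incidenceSet (Sum.inr j) = Set.range fun a => (a, (π a).symm j) := by
      ext ⟨a, x⟩
      simp only [Graph.mem_incidenceSet, Graph.Inc, permGraph, Set.mem_range, Prod.mk.injEq]
      constructor
      · rintro ⟨y, ⟨h, -⟩ | ⟨h, -⟩⟩
        · simp at h
        · exact ⟨a, rfl, by rw [Sum.inr.inj h]; simp⟩
      · rintro ⟨b, rfl, rfl⟩
        exact ⟨_, Or.inr ⟨by simp, rfl⟩⟩
    rw [h, ← Set.image_univ, Function.Injective.encard_image fun a b h => congrArg Prod.fst h]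
    simp

/-- Every `permGraph π` is bipartite and `k`-regular, so only expansion can fail. -/
lemma exists_of_mem_badTuples {n k : ℕ} {c : ℝ} {π : Fin k → Equiv.Perm (Fin n)}
    (hπ : π ∈ badTuples n k c) : ∃ A ⊆ Set.range (Sum.inl : Fin n → Fin n ⊕ Fin n),
      (A.ncard : ℝ) ≤ (n : ℝ) / 2 ∧
      ((nbhd (permGraph π) A).ncard : ℝ) < (1 + c) * (A.ncard : ℝ) := by
  by_contra! hcon
  refine hπ { disjoint := ?_, union_eq := ?_, encard_inputs := ?_, encard_outputs := ?_,
              bipartite := ?_, regular := fun v _ => encard_incidenceSet_permGraph π v,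
              expands := hcon }
  · exact Set.isCompl_range_inl_range_inr.disjoint
  · exact Set.range_inl_union_range_inr
  · rw [← Set.image_univ, Sum.inl_injective.encard_image]; simp
  · rw [← Set.image_univ, Sum.inr_injective.encard_image]; simp
  · rintro ⟨a, i⟩ -
    exact ⟨_, ⟨i, rfl⟩, _, ⟨π a i, rfl⟩, Or.inl ⟨rfl, rfl⟩⟩

open Finset in
/-- A tuple that is not an expander with constant `1 / m` maps some set of size `a` into a set of
size `a + a / m`. -/
lemma exists_finset_of_mem_badTuples {n k m : ℕ} (hm : 0 < m) {π : Fin k → Equiv.Perm (Fin n)}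
    (hπ : π ∈ badTuples n k (1 / m : ℝ)) : ∃ A B : Finset (Fin n),
      0 < #A ∧ 2 * #A ≤ n ∧ #B = #A + #A / m ∧ ∀ a, ∀ i ∈ A, π a i ∈ B := by
  classical
  obtain ⟨A, hA, hcard, hlt⟩ := exists_of_mem_badTuples hπ
  obtain ⟨A, rfl⟩ : ∃ A' : Finset (Fin n), A = Sum.inl '' (A' : Set (Fin n)) := by
    refine ⟨(Set.toFinite (Sum.inl ⁻¹' A)).toFinset, ?_⟩
    rw [Set.Finite.coe_toFinset, Set.image_preimage_eq_of_subset hA]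
  have hnbhd : nbhd (permGraph π) (Sum.inl '' (A : Set (Fin n))) =
      Sum.inr '' ((univ.biUnion fun a => A.image (π a) : Finset (Fin n)) : Set (Fin n)) := by
    ext y
    constructor
    · rintro ⟨x, ⟨i, hi, rfl⟩, ⟨a, j⟩, ⟨h1, h2⟩ | ⟨h1, -⟩⟩
      · obtain rfl : i = j := Sum.inl.inj h1
        refine ⟨π a i, ?_, h2.symm⟩
        simp only [coe_biUnion, Set.mem_iUnion, coe_image]
        exact ⟨a, by simp, i, hi, rfl⟩
      · simp at h1
    · rintro ⟨j, hj, rfl⟩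
      simp only [coe_biUnion, Set.mem_iUnion, coe_image] at hj
      obtain ⟨a, -, i, hi, rfl⟩ := hj
      exact ⟨Sum.inl i, ⟨i, hi, rfl⟩, (a, i), Or.inl ⟨rfl, rfl⟩⟩
  rw [hnbhd, Set.ncard_image_of_injective _ Sum.inr_injective,
    Set.ncard_image_of_injective _ Sum.inl_injective, Set.ncard_coe_finset,
    Set.ncard_coe_finset] at hlt
  rw [Set.ncard_image_of_injective _ Sum.inl_injective, Set.ncard_coe_finset] at hcard
  have h2 : 2 * #A ≤ n := by
    have : (2 * #A : ℝ) ≤ n := by linarith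
    exact_mod_cast this
  have hpos : 0 < #A := by
    rcases Nat.eq_zero_or_pos (#A) with h0 | h0
    · rw [h0] at hlt
      have : (0 : ℝ) ≤ #(univ.biUnion fun a => A.image (π a)) := by positivity
      simp only [Nat.cast_zero, mul_zero] at hlt
      linarith
    · exact h0
  have hle : #(univ.biUnion fun a => A.image (π a)) ≤ #A + #A / m := by
    have hm' : (0 : ℝ) < m := by exact_mod_cast hm
    have h3 : (#(univ.biUnion fun a => A.image (π a)) : ℝ) * m < (m + 1) * #A := by
      calc _ < (1 + 1 / (m : ℝ)) * #A * m := by gcongr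
        _ = _ := by field_simp
    have h4 : #(univ.biUnion fun a => A.image (π a)) * m < (m + 1) * #A := by exact_mod_cast h3
    rw [add_comm (#A), ← Nat.add_mul_div_right (#A) (#A) hm, Nat.le_div_iff_mul_le hm]
    linarith
  -- Padding the neighbourhood to an exact size leaves one size of `B` per `a`; it fits because `a +
  -- a / m ≤ 2 * a ≤ n`.
  obtain ⟨B, hB, hBc⟩ := exists_superset_card_eq hle (by
    have := Nat.div_le_self (#A) m
    rw [Fintype.card_fin]; omega)
  refine ⟨A, B, hpos, h2, hBc, fun a i hi => hB ?_⟩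
  simp only [mem_biUnion, mem_univ, true_and, mem_image]
  exact ⟨a, i, hi, rfl⟩

open Finset in
lemma card_tuples_mapsTo {n k : ℕ} (A B : Finset (Fin n)) :
    #{π : Fin k → Equiv.Perm (Fin n) | ∀ a, ∀ i ∈ A, π a i ∈ B} =
      #{σ : Equiv.Perm (Fin n) | ∀ i ∈ A, σ i ∈ B} ^ k := by
  rw [← Fintype.card_piFinset_const]
  congr 1
  ext π
  simp

open Finset in
/-- The union bound over the sets violating expansion. -/
lemma ncard_badTuples_div_le (n k m : ℕ) (hm : 0 < m) :
    ((badTuples n k (1 / m : ℝ)).ncard : ℝ) / (n.factorial : ℝ) ^ k ≤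
      ∑ a ∈ Icc 1 (n / 2), (n.choose a : ℝ) * n.choose (a + a / m) *
        ((a + a / m).choose a / n.choose a : ℝ) ^ k := by
  let U : Finset (Fin k → Equiv.Perm (Fin n)) :=
    (Icc 1 (n / 2)).biUnion fun a =>
      (powersetCard a univ ×ˢ powersetCard (a + a / m) univ).biUnion fun p =>
        {π | ∀ x, ∀ i ∈ p.1, π x i ∈ p.2}
  have hsub : badTuples n k (1 / m : ℝ) ⊆ U := by
    intro π hπ
    obtain ⟨A, B, h0, h2, hB, h⟩ := exists_finset_of_mem_badTuples hm hπ
    simp only [U, coe_biUnion, Set.mem_iUnion, mem_coe, mem_Icc, mem_product, mem_powersetCard,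
      subset_univ, true_and, mem_filter, mem_univ]
    exact ⟨#A, ⟨h0, by omega⟩, (A, B), ⟨rfl, hB⟩, h⟩
  have hU : ((badTuples n k (1 / m : ℝ)).ncard : ℝ) ≤ #U := by
    rw [← Set.ncard_coe_finset]
    exact_mod_cast Set.ncard_le_ncard hsub (Set.toFinite _)
  have hUle : (#U : ℝ) ≤ ∑ a ∈ Icc 1 (n / 2), ((n.choose a : ℝ) * n.choose (a + a / m) *
        ((a + a / m).choose a / n.choose a : ℝ) ^ k) * (n.factorial : ℝ) ^ k := by
    have h1 : #U ≤ ∑ a ∈ Icc 1 (n / 2),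
        ∑ p ∈ powersetCard a (univ : Finset (Fin n)) ×ˢ powersetCard (a + a / m) univ,
          #{π : Fin k → Equiv.Perm (Fin n) | ∀ x, ∀ i ∈ p.1, π x i ∈ p.2} :=
      card_biUnion_le.trans (sum_le_sum fun a _ => card_biUnion_le)
    refine (Nat.cast_le.2 h1).trans ?_
    rw [Nat.cast_sum]
    refine sum_le_sum fun a ha => ?_
    have ha' : a ≤ n := by have := (mem_Icc.1 ha).2; omega
    have hpos : (0 : ℝ) < n.choose a := by exact_mod_cast Nat.choose_pos ha'
    rw [Nat.cast_sum, sum_congr rfl (g := fun _ =>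
      ((a + a / m).choose a / n.choose a : ℝ) ^ k * (n.factorial : ℝ) ^ k)]
    · simp only [sum_const, card_product, card_powersetCard, card_univ, Fintype.card_fin,
        nsmul_eq_mul, Nat.cast_mul]
      exact le_of_eq (by ring)
    · rintro ⟨A, B⟩ hp
      simp only [mem_product, mem_powersetCard, subset_univ, true_and] at hp
      have h := choose_mul_card_perm_mapsTo A B
      rw [hp.1, hp.2] at h
      have h' : (n.choose a : ℝ) * #{σ : Equiv.Perm (Fin n) | ∀ i ∈ A, σ i ∈ B} =
          n.factorial * (a + a / m).choose a := by exact_mod_cast h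
      rw [card_tuples_mapsTo, Nat.cast_pow, ← mul_pow]
      congr 1
      field_simp
      linarith
  rw [div_le_iff₀ (by positivity), sum_mul]
  exact hU.trans hUle

/-! ### Binomial estimates and the limit. -/

lemma two_pow_le_choose_add {a s : ℕ} (h : s ≤ a) : 2 ^ s ≤ (a + s).choose s := by
  induction s with
  | zero => simp
  | succ s ih =>
    have h1 := Nat.add_one_mul_choose_eq (a + s) s
    have h2 := ih (by omega)
    refine Nat.le_of_mul_le_mul_right ?_ (Nat.succ_pos s)
    calc 2 ^ (s + 1) * (s + 1) = 2 * (s + 1) * 2 ^ s := by ring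
      _ ≤ (a + s + 1) * (a + s).choose s := Nat.mul_le_mul (by omega) h2
      _ = _ := h1

lemma sub_le_choose {n s : ℕ} (hs : 0 < s) (h : s ≤ n) : n - s ≤ n.choose s := by
  calc n - s ≤ (n - s + 1).choose (n - s) := by simp
    _ ≤ n.choose (n - s) := Nat.choose_le_choose _ (by omega)
    _ = n.choose s := Nat.choose_symm h

lemma choose_mul_pow_le_one_add_pow (N d : ℕ) {x : ℝ} (hx : 0 ≤ x) :
    N.choose d * x ^ d ≤ (1 + x) ^ N := by
  rcases lt_or_ge N d with h | h
  · rw [Nat.choose_eq_zero_of_lt h]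
    simp only [Nat.cast_zero, zero_mul]
    positivity
  · rw [add_comm, add_pow]
    simp only [one_pow, mul_one]
    rw [mul_comm]
    exact Finset.single_le_sum (f := fun m => x ^ m * (N.choose m : ℝ))
      (fun i _ => by positivity) (Finset.mem_range.2 (by omega))

/-- Three permutations suffice: the two choices of sets cost about two factors `n.choose a`, and the
third power of the probability leaves one in the denominator. The identities `e1` and `e2` make this
exact. -/
lemma union_bound_term_le {n a d k : ℕ} (hd : d ≤ a) (h : 2 * a ≤ n) (hk : 3 ≤ k) :
    (n.choose a : ℝ) * n.choose (a + d) * ((a + d).choose a / n.choose a : ℝ) ^ k ≤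
      ((2 * a).choose d : ℝ) ^ 3 / (n - d).choose (a - d) := by
  have hpos : (0 : ℝ) < n.choose a := by exact_mod_cast Nat.choose_pos (by omega)
  have hpos' : (0 : ℝ) < (n - d).choose (a - d) := by exact_mod_cast Nat.choose_pos (by omega)
  have hle1 : ((a + d).choose a / n.choose a : ℝ) ≤ 1 := by
    rw [div_le_one hpos]
    exact_mod_cast Nat.choose_le_choose a (by omega)
  have hpow : ((a + d).choose a / n.choose a : ℝ) ^ k ≤ ((a + d).choose a / n.choose a : ℝ) ^ 3 :=
    pow_le_pow_of_le_one (by positivity) hle1 hk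
  have e1 : (n.choose (a + d) : ℝ) * (a + d).choose a = n.choose a * (n - a).choose d := by
    have := Nat.choose_mul (n := n) (k := a + d) (s := a) (by omega)
    rw [Nat.add_sub_cancel_left] at this
    exact_mod_cast this
  have e2 : (n.choose a : ℝ) * a.choose d = n.choose d * (n - d).choose (a - d) := by
    exact_mod_cast Nat.choose_mul (n := n) hd
  have i1 : ((a + d).choose a : ℝ) ≤ (2 * a).choose d := by
    rw [Nat.choose_symm_add]
    exact_mod_cast Nat.choose_le_choose d (by omega)
  have i2 : ((n - a).choose d : ℝ) ≤ n.choose d := by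
    exact_mod_cast Nat.choose_le_choose d (by omega)
  have i3 : (a.choose d : ℝ) ≤ (2 * a).choose d := by
    exact_mod_cast Nat.choose_le_choose d (by omega)
  calc _ ≤ (n.choose a : ℝ) * n.choose (a + d) * ((a + d).choose a / n.choose a : ℝ) ^ 3 := by
        gcongr
    _ = (n.choose (a + d) * (a + d).choose a) * ((a + d).choose a : ℝ) ^ 2 / n.choose a ^ 2 := by
        field_simp
    _ = (n - a).choose d * ((a + d).choose a : ℝ) ^ 2 / n.choose a := by
        rw [e1]; field_simp
    _ ≤ n.choose d * ((2 * a).choose d : ℝ) ^ 2 / n.choose a := by gcongr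
    _ = a.choose d * ((2 * a).choose d : ℝ) ^ 2 / (n - d).choose (a - d) := by
        rw [div_eq_div_iff hpos.ne' hpos'.ne']
        linear_combination (-(((2 * a).choose d : ℝ) ^ 2)) * e2
    _ ≤ (2 * a).choose d * ((2 * a).choose d : ℝ) ^ 2 / (n - d).choose (a - d) := by gcongr
    _ = _ := by ring

/-- With `d = a / 128`, the denominator is at least `2 ^ (a - d)`, while `x = 1 / 32` in
`choose_mul_pow_le_one_add_pow` bounds the numerator. The powers with exponent `d` collect to `2 ^
(16 * d)`, absorbed by `(11 / 10) ^ a`. The resulting base is about `0.66`. -/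
lemma choose_pow_div_choose_le_geometric {n a : ℕ} (h : 2 * a ≤ n) :
    ((2 * a).choose (a / 128) : ℝ) ^ 3 / (n - a / 128).choose (a - a / 128) ≤
      ((33 / 32 : ℝ) ^ 6 * (11 / 10) / 2) ^ a := by
  obtain ⟨d, hd⟩ : ∃ d, a / 128 = d := ⟨_, rfl⟩
  rw [hd]
  have hda : 128 * d ≤ a := by omega
  have h1 : ((2 : ℝ) ^ (a - d)) ≤ (n - d).choose (a - d) := by
    have h2 := two_pow_le_choose_add (a := a) (s := a - d) (by omega)
    have h3 := Nat.choose_le_choose (a - d) (show a + (a - d) ≤ n - d by omega)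
    exact_mod_cast h2.trans h3
  have h2 : ((2 * a).choose d : ℝ) ≤ (33 / 32) ^ (2 * a) * 32 ^ d := by
    have := choose_mul_pow_le_one_add_pow (2 * a) d (x := 1 / 32) (by norm_num)
    rw [one_div, inv_pow, ← div_eq_mul_inv, div_le_iff₀ (by positivity)] at this
    norm_num at this ⊢
    exact this
  have h3 : ((2 : ℝ) ^ 16) ^ d ≤ (11 / 10) ^ a := by
    calc ((2 : ℝ) ^ 16) ^ d ≤ ((11 / 10 : ℝ) ^ 128) ^ d := by gcongr; norm_num
      _ = (11 / 10 : ℝ) ^ (128 * d) := by rw [← pow_mul]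
      _ ≤ _ := pow_le_pow_right₀ (by norm_num) hda
  have e1 : ((33 / 32 : ℝ) ^ (2 * a)) ^ 3 = ((33 / 32 : ℝ) ^ 6) ^ a := by
    rw [← pow_mul, ← pow_mul]
    congr 1
    ring
  have e2 : ((2 : ℝ) ^ 16) ^ d = (32 ^ d) ^ 3 * 2 ^ d := by
    rw [show (2 : ℝ) ^ 16 = 32 ^ 3 * 2 by norm_num, mul_pow, pow_right_comm]
  calc ((2 * a).choose d : ℝ) ^ 3 / (n - d).choose (a - d)
      ≤ ((33 / 32) ^ (2 * a) * 32 ^ d) ^ 3 / 2 ^ (a - d) := by gcongr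
    _ = ((33 / 32 : ℝ) ^ 6) ^ a * ((2 : ℝ) ^ 16) ^ d / 2 ^ a := by
        rw [pow_sub₀ _ two_ne_zero (by omega : d ≤ a), mul_pow, e1, e2]
        field_simp
    _ ≤ ((33 / 32 : ℝ) ^ 6) ^ a * (11 / 10) ^ a / 2 ^ a := by gcongr
    _ = _ := by rw [← mul_pow, ← div_pow]

lemma tendsto_sum_choose_pow_div_choose :
    Tendsto (fun n : ℕ => ∑ a ∈ Finset.Icc 1 (n / 2),
      ((2 * a).choose (a / 128) : ℝ) ^ 3 / (n - a / 128).choose (a - a / 128)) atTop (𝓝 0) := by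
  let f : ℕ → ℕ → ℝ := fun n a => if a ∈ Finset.Icc 1 (n / 2) then
    ((2 * a).choose (a / 128) : ℝ) ^ 3 / (n - a / 128).choose (a - a / 128) else 0
  have hf : ∀ n, ∑' a, f n a = ∑ a ∈ Finset.Icc 1 (n / 2),
      ((2 * a).choose (a / 128) : ℝ) ^ 3 / (n - a / 128).choose (a - a / 128) := by
    intro n
    rw [tsum_eq_sum (s := Finset.Icc 1 (n / 2)) fun a ha => if_neg ha]
    exact Finset.sum_congr rfl fun a ha => if_pos ha
  have hnn : ∀ n a, 0 ≤ f n a := by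
    intro n a
    simp only [f]
    split_ifs <;> positivity
  -- Extension by zero makes the index set independent of `n`. For fixed `a ≥ 1` the denominator is
  -- at least `n - a`, which gives the pointwise limit.
  have key : Tendsto (∑' a, f · a) atTop (𝓝 (∑' _ : ℕ, (0 : ℝ))) := by
    refine tendsto_tsum_of_dominated_convergence
      (bound := fun a => ((33 / 32 : ℝ) ^ 6 * (11 / 10) / 2) ^ a)
      (summable_geometric_of_lt_one (by norm_num) (by norm_num)) ?_ ?_
    · intro a
      rcases Nat.eq_zero_or_pos a with rfl | ha
      · simp [f]
      have hlim : Tendsto (fun n : ℕ => ((2 * a).choose (a / 128) : ℝ) ^ 3 / ((n - a : ℕ) : ℝ))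
          atTop (𝓝 0) :=
        tendsto_const_nhds.div_atTop
          (tendsto_natCast_atTop_atTop.comp (tendsto_sub_atTop_nat a))
      refine squeeze_zero' (Eventually.of_forall fun n => hnn n a) ?_ hlim
      filter_upwards [eventually_ge_atTop (2 * a)] with n hn
      simp only [f]
      rw [if_pos (by rw [Finset.mem_Icc]; omega)]
      have h1 : n - a ≤ (n - a / 128).choose (a - a / 128) :=
        le_trans (by omega) (sub_le_choose (by omega) (by omega))
      have h2 : (0 : ℝ) < (n - a : ℕ) := by
        exact_mod_cast (by omega : 0 < n - a)
      gcongr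
    · refine Eventually.of_forall fun n a => ?_
      rw [Real.norm_of_nonneg (hnn n a)]
      simp only [f]
      split_ifs with h
      · exact choose_pow_div_choose_le_geometric (by rw [Finset.mem_Icc] at h; omega)
      · positivity
  rw [tsum_zero] at key
  exact key.congr hf

/-- Almost all `k`-tuples of permutations, `k ≥ 3`, give expanders with constant `1 / 128`. -/
lemma tendsto_ncard_badTuples_div {k : ℕ} (hk : 3 ≤ k) :
    Tendsto (fun n : ℕ => ((badTuples n k (1 / (128 : ℕ) : ℝ)).ncard : ℝ) /
      (n.factorial : ℝ) ^ k) atTop (𝓝 0) := by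
  refine squeeze_zero (fun n => by positivity) (fun n => ?_) tendsto_sum_choose_pow_div_choose
  refine (ncard_badTuples_div_le n k 128 (by norm_num)).trans (Finset.sum_le_sum fun a ha => ?_)
  rw [Finset.mem_Icc] at ha
  exact union_bound_term_le (by omega) (by omega) hk

theorem mainTheorem5 :
    (∀ (n k : ℕ) (π : Fin k → Equiv.Perm (Fin n)),
      π ∈ simpleTuples n k ↔ IsLatinRectangle (permMatrix π)) ∧
    (∀ n k : ℕ, (simpleTuples n k).ncard =
      {A : Matrix (Fin k) (Fin n) (Fin n) | IsLatinRectangle A}.ncard) ∧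
    (∀ n k : ℕ, k ≤ n → 0 < (simpleTuples n k).ncard) ∧
    (∀ (k : ℕ) (c : ℝ),
      Tendsto (fun n : ℕ => ((badTuples n k c).ncard : ℝ) / (n.factorial : ℝ) ^ k)
        atTop (𝓝 0) →
      Tendsto (fun n : ℕ => ((badTuples n k c ∩ simpleTuples n k).ncard : ℝ) /
        ((simpleTuples n k).ncard : ℝ)) atTop (𝓝 0)) ∧
    (∃ c : ℝ, 0 < c ∧ ∀ k : ℕ, 3 ≤ k →
      Tendsto (fun n : ℕ => ((badTuples n k c ∩ simpleTuples n k).ncard : ℝ) /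
        ((simpleTuples n k).ncard : ℝ)) atTop (𝓝 0)) :=
  ⟨fun _ _ π => mem_simpleTuples_iff_isLatinRectangle π,
    ncard_simpleTuples_eq_ncard_isLatinRectangle,
    fun _ _ h => ncard_simpleTuples_pos h,
    fun k c h => tendsto_ncard_inter_simpleTuples_div (fun n => badTuples n k c) h,
    1 / (128 : ℕ), by norm_num, fun k hk =>
      tendsto_ncard_inter_simpleTuples_div (fun n => badTuples n k (1 / (128 : ℕ) : ℝ))
        (tendsto_ncard_badTuples_div hk)⟩
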